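/- Let $k$ be an algebraically closed field and let $A$ and $B$ be finite dimensional $k$-algebras that are connected (not isomorphic to a direct product of two nonzero $k$-algebras) and basic (in every decomposition of the left regular module into indecomposable summands, the summands are pairwise nonisomorphic). For such an algebra $A$ let $D^b(A)$ be the bounded derived category of finitely generated left $A$-modules. An object $X$ of $D^b(A)$ is *compact* if it is quasi-isomorphic to a perfect complex, i.e. to a bounded complex of finitely generated projective left $A$-modules; it is *exceptional* if $\operatorname{Hom}_{D^b(A)}(X, X[n]) = 0$ for all integers $n \neq 0$. A perfect complex $P^\bullet$ is *minimal* if, as a complex, it has no direct summand of the form $\cdots \to 0 \to Q \xrightarrow{\mathrm{id}} Q \to 0 \to \cdots$ with $Q \neq 0$ a finitely generated projective module. If $X \neq 0$ is compact, its *length* is $l(X) = s - r + 1$, where $r$ and $s$ are the degrees of the first and the last nonzero terms of a minimal perfect complex quasi-isomorphic to $X$ (such a complex exists and is unique up to isomorphism). **Theorem.** Suppose that $D^b(A)$ and $D^b(B)$ are equivalent as triangulated categories. If the lengths of all indecomposable compact exceptional objects of $D^b(A)$ are bounded by some integer, then the lengths of all indecomposable compact exceptional objects of $D^b(B)$ are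 bounded by some integer. -/

import Mathlib

open CategoryTheory CategoryTheory.Limits

universe u v

namespace DerivedLength

/-! ### Basic and connected algebras -/

/-- A module is indecomposable if it is nonzero and is not the internal direct sum of two nonzero
submodules. -/
def IsIndecomposableModule (R M : Type*) [Ring R] [AddCommGroup M] [Module R M] : Prop :=
  Nontrivial M ∧ ∀ N N' : Submodule R M, IsCompl N N' → N = ⊥ ∨ N' = ⊥

/-- The ring `A` is basic: in every finite decomposition of the left regular module `A` into
indecomposable summands, the summands are pairwise nonisomorphic. -/
def IsBasic (A : Type*) [Ring A] : Prop :=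
  ∀ (n : ℕ) (P : Fin n → Submodule A A), DirectSum.IsInternal P →
    (∀ i, IsIndecomposableModule A (P i)) →
      ∀ i j, i ≠ j → IsEmpty (P i ≃ₗ[A] P j)

/-- The `k`-algebra `A` is connected: it is not isomorphic to a direct product (that is, a
direct sum as an algebra) of two nonzero algebras. -/
def IsConnected (k : Type v) (A : Type u) [Field k] [Ring A] [Algebra k A] : Prop :=
  ∀ (A₁ A₂ : Type u) [Ring A₁] [Algebra k A₁] [Ring A₂] [Algebra k A₂],
    Nontrivial A₁ → Nontrivial A₂ → IsEmpty (A ≃ₐ[k] (A₁ × A₂))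

section

variable (A : Type u) [Ring A] [IsNoetherianRing A]

/-! ### The bounded derived category -/

/-- The localization used to form the derived category of finitely generated left `A`-modules. -/
noncomputable instance instHasDerivedCategory :
    HasDerivedCategory.{u + 1} (FGModuleCat.{u} A) :=
  HasDerivedCategory.standard _

/-- The bounded derived category `D^b(A)` of finitely generated left `A`-modules: the full
(triangulated) subcategory of the derived category of finitely generated left `A`-modules on the
objects with bounded cohomology. -/
abbrev Db : Type (u + 1) :=
  (DerivedCategory.TStructure.t (C := FGModuleCat.{u} A)).bounded.FullSubcategory

variable {A}

/-- `A` and `B` are derived equivalent: there is an equivalence of categories `D^b(A) ≌ D^b(B)`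
which commutes with the shifts and preserves distinguished triangles. -/
def DerivedEquivalent (A : Type u) [Ring A] [IsNoetherianRing A]
    (B : Type v) [Ring B] [IsNoetherianRing B] : Prop :=
  ∃ (E : Db A ≌ Db B) (_ : E.functor.CommShift ℤ), E.functor.IsTriangulated

/-! ### Perfect complexes, minimality and length -/

/-- A perfect complex: a bounded complex of finitely generated projective left `A`-modules. -/
def IsPerfect (P : CochainComplex (FGModuleCat.{u} A) ℤ) : Prop :=
  (∀ i, Module.Projective A (P.X i)) ∧ ∃ a b : ℤ, P.IsStrictlyGE a ∧ P.IsStrictlyLE b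

/-- The complex `⋯ ⟶ 0 ⟶ M ⟶ M ⟶ 0 ⟶ ⋯` with the identity of `M` as its differential from
degree `i` to degree `i + 1`. -/
noncomputable def identityComplex (M : FGModuleCat.{u} A) (i : ℤ) :
    CochainComplex (FGModuleCat.{u} A) ℤ :=
  HomologicalComplex.double (𝟙 M) (show (ComplexShape.up ℤ).Rel i (i + 1) from rfl)

/-- A complex is minimal if it has no direct summand of the form
`⋯ ⟶ 0 ⟶ M ⟶ M ⟶ 0 ⟶ ⋯` (with identity differential), where `M` is a nonzero finitely generated
projective module. -/
def IsMinimal (P : CochainComplex (FGModuleCat.{u} A) ℤ) : Prop :=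
  ∀ (M : FGModuleCat.{u} A) (i : ℤ) (R : CochainComplex (FGModuleCat.{u} A) ℤ),
    Module.Projective A M → (P ≅ identityComplex M i ⊞ R) → IsZero M

/-- The object `X` of `D^b(A)` is quasi-isomorphic to the complex `P`, that is, isomorphic to it
in the derived category. -/
def IsRepresentedBy (X : Db A) (P : CochainComplex (FGModuleCat.{u} A) ℤ) : Prop :=
  Nonempty (X.obj ≅ DerivedCategory.Q.obj P)

/-- An object of `D^b(A)` is compact if it is quasi-isomorphic to a perfect complex.

These are the objects `X` of `D^b(A)` such that `Hom(X, -)` commutes with small coproducts in the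
derived category of all `A`-modules. (Inside `D^b(A)` itself no infinite family of nonzero objects
has a coproduct, so commutation with the coproducts of `D^b(A)` would be no condition at all.) -/
def IsCompactObject (X : Db A) : Prop :=
  ∃ P : CochainComplex (FGModuleCat.{u} A) ℤ, IsPerfect P ∧ IsRepresentedBy X P

/-- An object `X` is exceptional (rigid) if `Hom(X, X[n]) = 0` for all `n ≠ 0`. -/
def IsExceptional (X : Db A) : Prop :=
  ∀ n : ℤ, n ≠ 0 → ∀ f : X ⟶ (shiftFunctor (Db A) n).obj X, f = 0

/-- The (nonzero) object `X` has length `l`: it is quasi-isomorphic to a minimal perfect complex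
`P` whose first and last nonzero terms are in degrees `r` and `s`, and `l = s - r + 1`. -/
def HasLength (X : Db A) (l : ℤ) : Prop :=
  ∃ P : CochainComplex (FGModuleCat.{u} A) ℤ, IsPerfect P ∧ IsMinimal P ∧ IsRepresentedBy X P ∧
    ∃ r s : ℤ, ¬ IsZero (P.X r) ∧ ¬ IsZero (P.X s) ∧
      (∀ i, ¬ IsZero (P.X i) → r ≤ i ∧ i ≤ s) ∧ l = s - r + 1

variable (A)

/-- The lengths of the indecomposable compact exceptional objects of `D^b(A)` are bounded. -/
def BoundedExceptionalLengths : Prop :=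
  BddAbove {l : ℤ | ∃ X : Db A,
    Indecomposable X ∧ IsCompactObject X ∧ IsExceptional X ∧ HasLength X l}

end

end DerivedLength

/-!
The proof compares lengths through morphisms into stalk complexes, which an equivalence controls.

Let `J` be the radical of `B` and `T = B ⧸ J`. If `P` is a minimal perfect complex whose first and
last nonzero terms are in degrees `r` and `s`, then `Hom(P, T[-r]) ≠ 0` and `Hom(P, T[-s]) ≠ 0`
(`IsMinimal.not_homVanishes_first`, `IsMinimal.not_homVanishes_last`). Indeed the modules `M` with
`Hom(Z, M[-n]) = 0` are closed under extensions and retracts, and every module is built from `T` in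
this way (`devissage`), so that if one of these groups vanished, it would vanish for all modules in
place of `T`; with `M = P^r`, respectively `M = coker (P^{s-1} ⟶ P^s)`, this would split off a
contractible summand at the end of `P`. Conversely, `Hom(P, Y) = 0` whenever the cohomology of `Y`
lies entirely below `r` or entirely above `s` (`eq_zero_of_bounds`).

Let `F : D^b(A) ≌ D^b(B)` be an equivalence with inverse `G`. As `G` commutes with shifts, there is
a constant `c` such that `G(T[-n])` has cohomology in `[n - c, n + c]` for all `n`. If `X` has
minimal complex `P` in degrees `[r, s]` and `G X` has minimal complex `P'` in degrees `[r', s']`,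
the nonzero morphisms `G X ⟶ G(T[-r])` and `G X ⟶ G(T[-s])` give `r' ≤ r + c` and `s - c ≤ s'`, so
the length of `X` is at most the length of `G X` plus `2 * c`.

That `G X` has a minimal perfect complex at all rests on a description of perfect objects that is
invariant under equivalence: a bounded object `Z` with `Hom(Z, M[-n]) = 0` for all modules `M` and
all `n < m`, where `m` does not depend on `M`, is perfect (`isPerfectObject_of_homVanishes`). By
dévissage it suffices to test `M = A ⧸ J`, and there the vanishing comes from the shape of `P` and
the bounds on the cohomology of `F((A ⧸ J)[-n])` (`isPerfectObject_obj`). A perfect complex with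
terms of least total length among those isomorphic to it is minimal (`exists_minimal`).
-/

open CategoryTheory.Pretriangulated CategoryTheory.Triangulated DerivedCategory

universe w

namespace DerivedLength

/-! ### Bounded complexes of projective objects -/

section Projective

variable {C : Type u} [Category.{v} C] [Abelian C]

lemma projective_single_X (P : C) [Projective P] (n i : ℤ) :
    Projective (((HomologicalComplex.single C (ComplexShape.up ℤ) n).obj P).X i) := by
  by_cases h : i = n
  · subst h
    exact Projective.of_iso (HomologicalComplex.singleObjXSelf _ _ _).symm inferInstance
  · exact Projective.of_iso
      ((isZero_zero C).iso (HomologicalComplex.isZero_single_obj_X _ _ _ _ h)) inferInstance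

lemma isZero_mappingCone_X {K L : CochainComplex C ℤ} (φ : K ⟶ L) (i : ℤ)
    (hL : IsZero (L.X i)) (hK : IsZero (K.X (i + 1))) :
    IsZero ((CochainComplex.mappingCone φ).X i) :=
  HomologicalComplex.homotopyCofiber.isZero_X φ i hL (by rintro _ rfl; exact hK)

/-- A map `β` such that `α ≫ d ≫ β` is the identity of `M` splits off a contractible summand
`M ⟶ M` in degrees `i` and `i + 1`. -/
lemma exists_iso_double_biprod (K : CochainComplex C ℤ) {M : C} {i : ℤ} (α : M ⟶ K.X i)
    (β : K.X (i + 1) ⟶ M) (h : α ≫ K.d i (i + 1) ≫ β = 𝟙 M) :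
    ∃ R : CochainComplex C ℤ, Nonempty (K ≅ HomologicalComplex.double (𝟙 M)
      (show (ComplexShape.up ℤ).Rel i (i + 1) from rfl) ⊞ R) := by
  have hi : i ≠ i + 1 := by lia
  have hr : (ComplexShape.up ℤ).Rel i (i + 1) := rfl
  let D := HomologicalComplex.double (𝟙 M) hr
  let e₀ : D.X i ≅ M := HomologicalComplex.doubleXIso₀ (𝟙 M) hr
  let e₁ : D.X (i + 1) ≅ M := HomologicalComplex.doubleXIso₁ (𝟙 M) hr hi
  have hD : D.d i (i + 1) = e₀.hom ≫ e₁.inv := by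
    rw [show D.d i (i + 1) = _ from HomologicalComplex.double_d (𝟙 M) hr hi, Category.id_comp]
  have hD' : ∀ a b, a ≠ i → D.d a b = 0 :=
    fun a b ↦ HomologicalComplex.double_d_eq_zero₀ (𝟙 M) hr a b
  let ι : D ⟶ K := HomologicalComplex.mkHomFromDouble hr hi α (α ≫ K.d i (i + 1)) (by simp) (by simp)
  have hι₀ : ι.f i = e₀.hom ≫ α := HomologicalComplex.mkHomFromDouble_f₀ ..
  have hι₁ : ι.f (i + 1) = e₁.hom ≫ α ≫ K.d i (i + 1) := HomologicalComplex.mkHomFromDouble_f₁ ..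
  let π : K ⟶ D :=
    { f := fun j ↦
        if h₀ : j = i then
          eqToHom (by rw [h₀]) ≫ K.d i (i + 1) ≫ β ≫ e₀.inv ≫ eqToHom (by rw [h₀])
        else if h₁ : j = i + 1 then
          eqToHom (by rw [h₁]) ≫ β ≫ e₁.inv ≫ eqToHom (by rw [h₁])
        else 0
      comm' := by
        rintro j _ rfl
        by_cases h₀ : j = i
        · subst h₀
          simp [hD]
        · rw [hD' _ _ h₀, comp_zero]
          by_cases h₁ : j + 1 = i
          · subst h₁
            simp
          · rw [dif_neg h₁, dif_neg (by lia), comp_zero] }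
  have hπ₀ : π.f i = K.d i (i + 1) ≫ β ≫ e₀.inv := by
    simp [π]
  have hπ₁ : π.f (i + 1) = β ≫ e₁.inv := by
    simp [π]
  have hιπ : ι ≫ π = 𝟙 D := by
    apply HomologicalComplex.to_double_hom_ext
    · rw [HomologicalComplex.comp_f, hι₀, hπ₀]
      simp [reassoc_of% h]
    · rw [HomologicalComplex.comp_f, hι₁, hπ₁]
      simp [reassoc_of% h]
  have : IsSplitMono ι := ⟨⟨⟨π, hιπ⟩⟩⟩
  have hlim := isBilimitBinaryBiconeOfIsSplitMonoOfCokernel (cokernelIsCokernel ι)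
  exact ⟨cokernel ι, ⟨biprod.uniqueUpToIso _ _ hlim⟩⟩

variable [HasDerivedCategory.{w} C]

/-- Morphisms in the derived category out of a K-projective complex are represented by chain maps. -/
lemma exists_Q_map_eq {P L : CochainComplex C ℤ} [P.IsKProjective] (f : Q.obj P ⟶ Q.obj L) :
    ∃ φ : P ⟶ L, Q.map φ = f := by
  obtain ⟨g, hg⟩ := (CochainComplex.IsKProjective.Qh_map_bijective P
    ((HomotopyCategory.quotient _ _).obj L)).surjective
      ((quotientCompQhIso C).hom.app P ≫ f ≫ (quotientCompQhIso C).inv.app L)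
  obtain ⟨φ, rfl⟩ := (HomotopyCategory.quotient _ _).map_surjective g
  refine ⟨φ, ?_⟩
  rw [← cancel_epi ((quotientCompQhIso C).hom.app P), ← quotientCompQhIso_hom_naturality, hg]
  simp

lemma nonempty_homotopy_of_Q_map_eq_zero {P L : CochainComplex C ℤ} [P.IsKProjective]
    (φ : P ⟶ L) (h : Q.map φ = 0) : Nonempty (Homotopy φ 0) := by
  refine ⟨HomotopyCategory.homotopyOfEq _ _ ?_⟩
  apply (CochainComplex.IsKProjective.Qh_map_bijective P
    ((HomotopyCategory.quotient _ _).obj L)).injective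
  rw [← cancel_mono ((quotientCompQhIso C).hom.app L), quotientCompQhIso_hom_naturality, h]
  simp

/-- There are no nonzero morphisms from a bounded complex of projectives in degrees `≥ r` to an
object with cohomology in degrees `< r`. -/
lemma eq_zero_of_isLE_of_projective {P : CochainComplex C ℤ} [∀ i, Projective (P.X i)]
    {r s m : ℤ} [P.IsStrictlyGE r] [P.IsStrictlyLE s] (hm : m < r)
    {Y : DerivedCategory C} [Y.IsLE m] (f : Q.obj P ⟶ Y) : f = 0 := by
  have := CochainComplex.isKProjective_of_projective P s
  obtain ⟨K, _, ⟨e⟩⟩ := exists_iso_Q_obj_of_isLE Y m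
  obtain ⟨φ, hφ⟩ := exists_Q_map_eq (f ≫ e.hom)
  have : φ = 0 := by
    ext i
    by_cases hi : i < r
    · exact (P.isZero_of_isStrictlyGE r i hi).eq_of_src _ _
    · exact (K.isZero_of_isStrictlyLE m i (by lia)).eq_of_tgt _ _
  rw [← cancel_mono e.hom, ← hφ, this]
  simp

end Projective

/-! ### Morphisms into stalk complexes -/

section HomVanishes

variable {C : Type u} [Category.{v} C] [Abelian C] [HasDerivedCategory.{w} C]

/-- `HomVanishes Z n M`: every morphism from `Z` to the stalk complex `M` in degree `n`,
that is to `M[-n]`, is zero. -/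
def HomVanishes (Z : DerivedCategory C) (n : ℤ) (M : C) : Prop :=
  ∀ f : Z ⟶ (singleFunctor C n).obj M, f = 0

lemma bounded_single (M : C) (n : ℤ) : TStructure.t.bounded ((singleFunctor C n).obj M) :=
  ⟨⟨n, inferInstance⟩, ⟨n, inferInstance⟩⟩

lemma HomVanishes.of_shortExact {Z : DerivedCategory C} {n : ℤ} {S : ShortComplex C}
    (hS : S.ShortExact) (h₁ : HomVanishes Z n S.X₁) (h₃ : HomVanishes Z n S.X₃) :
    HomVanishes Z n S.X₂ := by
  intro f
  obtain ⟨g, hg⟩ := Triangle.coyoneda_exact₂ _ (triangleOfSES_distinguished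
    (hS.map_of_exact (HomologicalComplex.single C (ComplexShape.up ℤ) n))) f (h₃ _)
  rw [hg, h₁ g]
  exact zero_comp

lemma HomVanishes.of_retract {Z : DerivedCategory C} {n : ℤ} {M N : C}
    (r : Retract M N) (h : HomVanishes Z n N) : HomVanishes Z n M := by
  intro f
  have : f ≫ (singleFunctor C n).map r.i ≫ (singleFunctor C n).map r.r = f := by
    rw [← Functor.map_comp, r.retract]; simp
  rw [← this, ← Category.assoc, h (f ≫ _), zero_comp]

/-- Vanishing on stalk complexes in degrees `≤ N` extends to all bounded objects `Y` with
cohomology in degrees `≤ N`; the induction is on a bound `d` for the number of these degrees. -/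
lemma eq_zero_of_forall_homVanishes {Z : DerivedCategory C} {N : ℤ}
    (hZ : ∀ n ≤ N, ∀ M, HomVanishes Z n M) (d : ℕ) :
    ∀ (Y : DerivedCategory C) (a : ℤ), Y.IsGE a → Y.IsLE N → N < a + d →
      ∀ f : Z ⟶ Y, f = 0 := by
  induction d with
  | zero =>
    intro Y a _ _ h f
    exact (TStructure.t.isZero Y N a (by simpa using h)).eq_of_tgt _ _
  | succ d ih =>
    intro Y a _ _ h f
    by_cases hN : N < a
    · exact (TStructure.t.isZero Y N a hN).eq_of_tgt _ _
    have hT := TStructure.t.triangleLTGE_distinguished (a + 1) Y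
    have : TStructure.t.IsGE ((TStructure.t.truncLT (a + 1)).obj Y) a := inferInstance
    have : TStructure.t.IsLE ((TStructure.t.truncLT (a + 1)).obj Y) a := inferInstance
    have h₃ : ∀ g : Z ⟶ (TStructure.t.truncGE (a + 1)).obj Y, g = 0 :=
      ih _ (a + 1) inferInstance inferInstance (by push_cast at h; lia)
    obtain ⟨M, ⟨e⟩⟩ := exists_iso_singleFunctor_obj_of_isGE_of_isLE
      ((TStructure.t.truncLT (a + 1)).obj Y) a
    have h₁ : ∀ g : Z ⟶ (TStructure.t.truncLT (a + 1)).obj Y, g = 0 := fun g ↦ by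
      rw [← cancel_mono e.hom, zero_comp]
      exact hZ a (by lia) M _
    obtain ⟨g, hg⟩ := Triangle.coyoneda_exact₂ _ hT f (h₃ _)
    rw [hg, h₁ g]
    exact zero_comp

/-- Applied to the tautological map from `P` to its first term, the vanishing yields a null homotopy,
whose only nonzero component is a retraction of the first differential. -/
lemma exists_d_comp_eq_id_of_homVanishes {P : CochainComplex C ℤ} [∀ i, Projective (P.X i)]
    {r s : ℤ} [P.IsStrictlyGE r] [P.IsStrictlyLE s]
    (h : ∀ M, HomVanishes (Q.obj P) r M) :
    ∃ β : P.X (r + 1) ⟶ P.X r, P.d r (r + 1) ≫ β = 𝟙 _ := by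
  have := CochainComplex.isKProjective_of_projective P s
  let φ : P ⟶ (HomologicalComplex.single C _ r).obj (P.X r) :=
    HomologicalComplex.mkHomToSingle (𝟙 _) (fun i (hi : i + 1 = r) ↦
      (P.isZero_of_isStrictlyGE r i (by lia)).eq_of_src _ _)
  have hφ : φ.f r = 𝟙 _ ≫ _ := HomologicalComplex.mkHomToSingle_f _ _
  obtain ⟨H⟩ := nonempty_homotopy_of_Q_map_eq_zero φ (h (P.X r) _)
  have h₁ : dNext r H.hom = P.d r (r + 1) ≫ H.hom (r + 1) r := dNext_eq _ rfl
  have h₂ : prevD r H.hom = 0 := by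
    rw [prevD_eq H.hom (show (ComplexShape.up ℤ).Rel (r - 1) r by simp)]
    simp
  have h₃ := H.comm r
  rw [h₁, h₂, hφ] at h₃
  let e := HomologicalComplex.singleObjXSelf (ComplexShape.up ℤ) r (P.X r)
  refine ⟨H.hom (r + 1) r ≫ e.hom, ?_⟩
  have h₄ := h₃ =≫ e.hom
  simpa [e] using h₄.symm

/-- Applied to the map from `P` to its top cohomology, the vanishing shows that the last
differential is an epimorphism; it splits as the last term is projective. -/
lemma exists_comp_d_eq_id_of_homVanishes {P : CochainComplex C ℤ} [∀ i, Projective (P.X i)]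
    {i : ℤ} [P.IsStrictlyLE (i + 1)]
    (h : ∀ M, HomVanishes (Q.obj P) (i + 1) M) :
    ∃ α : P.X (i + 1) ⟶ P.X i, α ≫ P.d i (i + 1) = 𝟙 _ := by
  have := CochainComplex.isKProjective_of_projective P (i + 1)
  let φ : P ⟶ (HomologicalComplex.single C _ (i + 1)).obj (cokernel (P.d i (i + 1))) :=
    HomologicalComplex.mkHomToSingle (cokernel.π _) (fun j (hj : j + 1 = i + 1) ↦ by
      obtain rfl : j = i := by lia
      simp)
  have hφ : φ.f (i + 1) = cokernel.π _ ≫ _ := HomologicalComplex.mkHomToSingle_f _ _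
  obtain ⟨H⟩ := nonempty_homotopy_of_Q_map_eq_zero φ (h (cokernel (P.d i (i + 1))) _)
  have h₁ : dNext (i + 1) H.hom = 0 := by
    rw [dNext_eq H.hom (show (ComplexShape.up ℤ).Rel (i + 1) (i + 1 + 1) from rfl),
      (P.isZero_of_isStrictlyLE (i + 1) (i + 1 + 1)).eq_of_tgt (P.d (i + 1) (i + 1 + 1)) 0, zero_comp]
  have h₂ : prevD (i + 1) H.hom = 0 := by
    rw [prevD_eq H.hom (show (ComplexShape.up ℤ).Rel i (i + 1) from rfl)]
    simp
  have h₃ := H.comm (i + 1)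
  rw [h₁, h₂, hφ] at h₃
  let e := HomologicalComplex.singleObjXSelf (ComplexShape.up ℤ) (i + 1) (cokernel (P.d i (i + 1)))
  have hd : Epi (P.d i (i + 1)) := by
    apply Preadditive.epi_of_cokernel_zero
    simpa [e] using h₃ =≫ e.hom
  exact ⟨Projective.factorThru (𝟙 _) (P.d i (i + 1)), Projective.factorThru_comp _ _⟩

end HomVanishes

/-! ### Perfect objects of the derived category -/

section PerfectObject

variable {C : Type u} [Category.{v} C] [Abelian C] [HasDerivedCategory.{w} C]

/-- The objects of the derived category which are isomorphic to a bounded complex of projective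
objects. -/
def IsPerfectObject (X : DerivedCategory C) : Prop :=
  ∃ (P : CochainComplex C ℤ) (a b : ℤ), (∀ i, Projective (P.X i)) ∧ P.IsStrictlyGE a ∧
    P.IsStrictlyLE b ∧ Nonempty (X ≅ Q.obj P)

lemma IsPerfectObject.of_iso {X Y : DerivedCategory C} (e : X ≅ Y) (h : IsPerfectObject X) :
    IsPerfectObject Y := by
  obtain ⟨P, a, b, h₁, h₂, h₃, ⟨e'⟩⟩ := h
  exact ⟨P, a, b, h₁, h₂, h₃, ⟨e.symm ≪≫ e'⟩⟩

lemma IsPerfectObject.shift {X : DerivedCategory C} (h : IsPerfectObject X) (n : ℤ) :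
    IsPerfectObject (X⟦n⟧) := by
  obtain ⟨P, a, b, h₁, h₂, h₃, ⟨e⟩⟩ := h
  refine ⟨P⟦n⟧, a - n, b - n, fun i ↦ h₁ _, P.isStrictlyGE_shift a n _ (by lia),
    P.isStrictlyLE_shift b n _ (by lia),
    ⟨(shiftFunctor _ n).mapIso e ≪≫ (Q.commShiftIso n).symm.app P⟩⟩

lemma isPerfectObject_single (P : C) [Projective P] (n : ℤ) :
    IsPerfectObject ((singleFunctor C n).obj P) := by
  exact ⟨(HomologicalComplex.single C _ n).obj P, n, n, projective_single_X P n, inferInstance,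
    inferInstance, ⟨Iso.refl _⟩⟩

lemma IsPerfectObject.of_triangle (T : Triangle (DerivedCategory C)) (hT : T ∈ distTriang _)
    (h₁ : IsPerfectObject T.obj₁) (h₂ : IsPerfectObject T.obj₂) : IsPerfectObject T.obj₃ := by
  obtain ⟨P, a, b, hP, _, _, ⟨e⟩⟩ := h₁
  obtain ⟨P', a', b', hP', _, _, ⟨e'⟩⟩ := h₂
  have := CochainComplex.isKProjective_of_projective P b
  obtain ⟨φ, hφ⟩ := exists_Q_map_eq (e.inv ≫ T.mor₁ ≫ e'.hom)
  have comm : T.mor₁ ≫ e'.hom = e.hom ≫ Q.map φ := by simp [hφ]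
  refine ⟨CochainComplex.mappingCone φ, min (a - 1) a', max b b', fun i ↦ ?_, ?_, ?_,
    ⟨Triangle.π₃.mapIso (isoTriangleOfIso₁₂ _ _ hT (mappingCone_triangle_distinguished φ) e e'
      comm)⟩⟩
  · exact Projective.of_iso (HomologicalComplex.homotopyCofiber.XIsoBiprod φ i (i + 1) rfl).symm
      inferInstance
  · rw [CochainComplex.isStrictlyGE_iff]
    intro i hi
    exact isZero_mappingCone_X φ i (P'.isZero_of_isStrictlyGE a' i (by lia))
      (P.isZero_of_isStrictlyGE a (i + 1) (by lia))
  · rw [CochainComplex.isStrictlyLE_iff]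
    intro i hi
    exact isZero_mappingCone_X φ i (P'.isZero_of_isStrictlyLE b' i (by lia))
      (P.isZero_of_isStrictlyLE b (i + 1) (by lia))

lemma distinguished_of_iso₂ {D : Type*} [Category* D] [HasZeroObject D] [HasShift D ℤ]
    [Preadditive D] [∀ n : ℤ, (shiftFunctor D n).Additive] [Pretriangulated D]
    {T : Triangle D} (hT : T ∈ distTriang D) {Z : D} (e : T.obj₂ ≅ Z) :
    Triangle.mk (T.mor₁ ≫ e.hom) (e.inv ≫ T.mor₂) T.mor₃ ∈ distTriang D :=
  isomorphic_distinguished _ hT _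
    (Triangle.isoMk _ _ (Iso.refl _) e.symm (Iso.refl _)
      (show (T.mor₁ ≫ e.hom) ≫ e.inv = 𝟙 T.obj₁ ≫ T.mor₁ by simp)
      (show (e.inv ≫ T.mor₂) ≫ 𝟙 T.obj₃ = e.inv ≫ T.mor₂ by simp)
      (show T.mor₃ ≫ (𝟙 T.obj₁)⟦(1 : ℤ)⟧' = 𝟙 T.obj₃ ≫ T.mor₃ by simp))

/-- One step of a projective resolution: a projective object mapping onto the top cohomology of `Z`
leaves a cone with cohomology in smaller degrees. -/
lemma exists_triangle_single_projective [EnoughProjectives C] (Z : DerivedCategory C) (b : ℤ)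
    [Z.IsLE b] :
    ∃ (P : C) (_ : Projective P) (Z' : DerivedCategory C) (_ : Z'.IsLE (b - 1))
      (f : (singleFunctor C b).obj P ⟶ Z) (g : Z ⟶ Z')
      (h : Z' ⟶ ((singleFunctor C b).obj P)⟦(1 : ℤ)⟧), Triangle.mk f g h ∈ distTriang _ := by
  obtain ⟨K, _, ⟨e⟩⟩ := exists_iso_Q_obj_of_isLE Z b
  let S := (HomologicalComplex.single C (ComplexShape.up ℤ) b).obj (Projective.over (K.X b))
  let φ : S ⟶ K := HomologicalComplex.mkHomFromSingle (Projective.π (K.X b))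
    (fun j (hj : b + 1 = j) ↦ (K.isZero_of_isStrictlyLE b j (by lia)).eq_of_tgt _ _)
  have hφ : Epi (φ.f b) := by
    rw [show φ.f b = _ from HomologicalComplex.mkHomFromSingle_f _ _]
    exact epi_comp _ _
  let M := CochainComplex.mappingCone φ
  have hS : IsZero (S.X (b + 1)) := HomologicalComplex.isZero_single_obj_X _ _ _ _ (by lia)
  have hM : M.IsLE (b - 1) := by
    rw [CochainComplex.isLE_iff]
    intro i hi
    by_cases hib : i = b
    · subst hib
      rw [HomologicalComplex.exactAt_iff' M (i - 1) i (i + 1) (by simp) (by simp)]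
      refine (ShortComplex.exact_iff_epi _ ?_).2 ?_
      · refine IsZero.eq_of_tgt ?_ _ _
        exact isZero_mappingCone_X φ (i + 1) (K.isZero_of_isStrictlyLE i _ (by lia))
          (HomologicalComplex.isZero_single_obj_X _ _ _ _ (by lia))
      · change Epi (M.d (i - 1) i)
        -- In degree `i` the cone is `K.X i`, and its last differential extends the epimorphism
        -- `φ.f i` along the inclusion of `S.X i`.
        have h₁ : Epi ((CochainComplex.mappingCone.inr φ).f i) := by
          rw [Preadditive.epi_iff_cancel_zero]
          intro X g hg
          exact CochainComplex.mappingCone.ext_from φ (i + 1) i rfl (hS.eq_of_src _ _)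
            (hg.trans comp_zero.symm)
        have h₂ : (CochainComplex.mappingCone.inl φ).v i (i - 1) (by lia) ≫ M.d (i - 1) i =
            φ.f i ≫ (CochainComplex.mappingCone.inr φ).f i := by
          rw [CochainComplex.mappingCone.inl_v_d φ i (i - 1) (i + 1) (by lia) (by lia)]
          simp [S]
        have h₃ : Epi (φ.f i ≫ (CochainComplex.mappingCone.inr φ).f i) := epi_comp _ _
        rw [← h₂] at h₃
        exact epi_of_epi ((CochainComplex.mappingCone.inl φ).v i (i - 1) _) _
    · apply HomologicalComplex.ExactAt.of_isZero
      exact isZero_mappingCone_X φ i (K.isZero_of_isStrictlyLE b i (by lia))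
        (HomologicalComplex.isZero_single_obj_X _ _ _ _ (by lia))
  refine ⟨Projective.over (K.X b), inferInstance, Q.obj M, inferInstance, Q.map φ ≫ e.inv,
    e.hom ≫ Q.map (CochainComplex.mappingCone.inr φ),
    (Q.mapTriangle.obj (CochainComplex.mappingCone.triangle φ)).mor₃,
    distinguished_of_iso₂ (mappingCone_triangle_distinguished φ) e.symm⟩

/-- The case where the cohomology of `Z` is in degrees `≤ m`: the cone of a resolution step
`P[-m] ⟶ Z` then receives no nonzero morphism from `Z`, so that `Z` is a retract of `P[-m]`. -/
lemma isPerfectObject_of_isLE_of_homVanishes [EnoughProjectives C] {m : ℤ}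
    (Z : DerivedCategory C) (hb : TStructure.t.bounded Z) [Z.IsLE m]
    (hZ : ∀ n < m, ∀ M, HomVanishes Z n M) : IsPerfectObject Z := by
  obtain ⟨P, _, Z', _, f, g, h, hT⟩ := exists_triangle_single_projective Z m
  have hb' : TStructure.t.bounded Z' := by
    refine TStructure.t.bounded.ext_of_isTriangulatedClosed₃ _ hT ?_ hb
    exact bounded_single P m
  obtain ⟨⟨a, _⟩, -⟩ := hb'
  have hg : g = 0 := eq_zero_of_forall_homVanishes (N := m - 1) (fun n hn ↦ hZ n (by lia))
    (m - a).toNat Z' a inferInstance inferInstance (by lia) g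
  obtain ⟨s, hs⟩ : ∃ s : Z ⟶ (singleFunctor C m).obj P, 𝟙 Z = s ≫ f :=
    Triangle.coyoneda_exact₂ _ hT (𝟙 Z) (by subst hg; exact comp_zero)
  replace hs : s ≫ f = 𝟙 Z := hs.symm
  let r : Retract Z ((singleFunctor C m).obj P) := ⟨s, f, hs⟩
  have : Z.IsGE m := by
    rw [isGE_iff]
    intro i hi
    rw [IsZero.iff_id_eq_zero]
    have := (r.map (homologyFunctor C i)).retract
    rw [← this, (isZero_of_isGE ((singleFunctor C m).obj P) m i hi).eq_of_src
      (r.map (homologyFunctor C i)).r 0, comp_zero]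
  obtain ⟨Y, ⟨e⟩⟩ := exists_iso_singleFunctor_obj_of_isGE_of_isLE Z m
  have : Projective Y := by
    have hr : (singleFunctor C m).preimage (e.inv ≫ s) ≫
        (singleFunctor C m).preimage (f ≫ e.hom) = 𝟙 Y := by
      apply (singleFunctor C m).map_injective
      rw [Functor.map_comp, Functor.map_preimage, Functor.map_preimage, Category.assoc,
        reassoc_of% hs, e.inv_hom_id,
        CategoryTheory.Functor.map_id]
    exact (Retract.mk _ _ hr).projective
  exact (isPerfectObject_single Y m).of_iso e.symm

/-- A bounded object of finite projective dimension, in the sense that there are no nonzero morphisms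
to stalk complexes in degrees `< m`, is perfect. The natural number `d` counts the resolution steps
which reduce to cohomology in degrees `≤ m`. -/
lemma isPerfectObject_of_homVanishes [EnoughProjectives C] {m : ℤ} (d : ℕ) :
    ∀ (Z : DerivedCategory C), TStructure.t.bounded Z → Z.IsLE (m + d) →
      (∀ n < m, ∀ M, HomVanishes Z n M) → IsPerfectObject Z := by
  induction d with
  | zero =>
    intro Z hb hd hZ
    have : Z.IsLE m := by simpa using hd
    exact isPerfectObject_of_isLE_of_homVanishes Z hb hZ
  | succ d ih =>
    intro Z hb _ hZ
    obtain ⟨P, _, Z', hZ', f, g, h, hT⟩ := exists_triangle_single_projective Z (m + (d + 1 : ℕ))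
    have hP : IsPerfectObject ((singleFunctor C (m + (d + 1 : ℕ))).obj P) :=
      isPerfectObject_single _ _
    refine IsPerfectObject.of_triangle _ (inv_rot_of_distTriang _ hT)
      (IsPerfectObject.shift (ih Z' ?_ ?_ ?_) _) hP
    · refine TStructure.t.bounded.ext_of_isTriangulatedClosed₃ _ hT ?_ hb
      exact bounded_single P _
    · convert hZ' using 1
      push_cast
      ring
    · intro n hn M u
      obtain ⟨w, hw⟩ : ∃ w : ((singleFunctor C (m + (d + 1 : ℕ))).obj P)⟦(1 : ℤ)⟧ ⟶
          (singleFunctor C n).obj M, u = h ≫ w := Triangle.yoneda_exact₃ _ hT u (hZ n hn M _)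
      have : w = 0 := by
        let e : ((singleFunctor C (m + (d + 1 : ℕ))).obj P)⟦(1 : ℤ)⟧ ≅
            (singleFunctor C (m + d)).obj P :=
          ((singleFunctors C).shiftIso 1 (m + d) (m + (d + 1 : ℕ)) (by push_cast; ring)).app P
        have : e.inv ≫ w = 0 := by
          have := projective_single_X P (m + d)
          exact eq_zero_of_isLE_of_projective (r := m + d) (s := m + d) (m := n)
            (P := (HomologicalComplex.single C (ComplexShape.up ℤ) (m + d)).obj P) (by lia) _
        rw [← cancel_epi e.inv, this, comp_zero]
      rw [hw, this, comp_zero]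

end PerfectObject

/-! ### Finitely generated modules over an artinian ring -/

section Modules

variable {A : Type u} [Ring A]

lemma isZero_iff_subsingleton (M : FGModuleCat.{u} A) : IsZero M ↔ Subsingleton M := by
  rw [IsZero.iff_id_eq_zero]
  refine ⟨fun h ↦ ⟨fun x y ↦ ?_⟩, fun h ↦ by ext x; exact Subsingleton.elim _ _⟩
  have hx (x : M) : x = 0 := congr($(h).hom.hom x)
  rw [hx x, hx y]

/-- The length (as a natural number) of a finitely generated module. -/
noncomputable def moduleLength (M : FGModuleCat.{u} A) : ℕ := (Module.length A M).toNat

lemma moduleLength_of_iso {M N : FGModuleCat.{u} A} (e : M ≅ N) :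
    moduleLength M = moduleLength N := by
  rw [moduleLength, moduleLength, (FGModuleCat.isoToLinearEquiv e).length_eq]

variable (A) in
/-- The semisimple quotient `A ⧸ J`, for `J` the Jacobson radical. -/
noncomputable def radicalQuotient : FGModuleCat.{u} A :=
  FGModuleCat.of A (A ⧸ Module.jacobson A A)

section Semisimple

variable [IsArtinianRing A]

instance : IsSemisimpleModule A (A ⧸ Module.jacobson A A) :=
  (IsArtinian.isSemisimpleModule_iff_jacobson A (A ⧸ Module.jacobson A A)).2
    (Module.jacobson_quotient_jacobson A A)

instance : IsSemisimpleModule A (radicalQuotient A) :=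
  inferInstanceAs (IsSemisimpleModule A (A ⧸ Module.jacobson A A))

/-- A nonzero module has a simple quotient, and the simple quotients of `A` are direct summands of
the semisimple module `A ⧸ J`. -/
lemma exists_ne_zero_to_radicalQuotient (M : FGModuleCat.{u} A) (hM : ¬ IsZero M) :
    ∃ f : M ⟶ radicalQuotient A, f ≠ 0 := by
  have : Nontrivial M := by
    rwa [isZero_iff_subsingleton, not_subsingleton_iff_nontrivial] at hM
  obtain ⟨N, hN, -⟩ := (eq_top_or_exists_le_coatom (⊥ : Submodule A M)).resolve_left bot_ne_top
  have hS : IsSimpleModule A (M ⧸ N) := isSimpleModule_iff_isCoatom.2 hN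
  obtain ⟨I, hI, ⟨e⟩⟩ := isSimpleModule_iff_quot_maximal.1 hS
  have hle : Module.jacobson A A ≤ I := sInf_le hI.out
  obtain ⟨s, hs⟩ := IsSemisimpleModule.lifting_property (R := A)
    (M := A ⧸ Module.jacobson A A) (Submodule.factor hle)
    (Submodule.factor_surjective hle) LinearMap.id
  refine ⟨FGModuleCat.ofHom (s ∘ₗ e.toLinearMap ∘ₗ N.mkQ), fun h ↦ hN.1 ?_⟩
  rw [eq_top_iff]
  intro x _
  have h₁ : s (e (N.mkQ x)) = 0 := congr($(h).hom.hom x)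
  have h₂ : e (N.mkQ x) = 0 := by
    have := LinearMap.congr_fun hs (e (N.mkQ x))
    rw [LinearMap.comp_apply, h₁, map_zero] at this
    exact this.symm
  simpa using h₂

end Semisimple

variable [IsNoetherianRing A]

lemma epi_iff_surjective {M N : FGModuleCat.{u} A} (f : M ⟶ N) :
    Epi f ↔ Function.Surjective f.hom.hom := by
  rw [← ModuleCat.epi_iff_surjective]
  exact ((forget₂ (FGModuleCat.{u} A) (ModuleCat.{u} A)).epi_map_iff_epi f).symm

lemma mono_iff_injective {M N : FGModuleCat.{u} A} (f : M ⟶ N) :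
    Mono f ↔ Function.Injective f.hom.hom := by
  rw [← ModuleCat.mono_iff_injective]
  exact ((forget₂ (FGModuleCat.{u} A) (ModuleCat.{u} A)).mono_map_iff_mono f).symm

lemma projective_of_module_projective {M : FGModuleCat.{u} A} (h : Module.Projective A M) :
    Projective M where
  factors {E X} f e he := by
    obtain ⟨g, hg⟩ := Module.projective_lifting_property e.hom.hom f.hom.hom
      ((epi_iff_surjective e).1 he)
    exact ⟨FGModuleCat.ofHom g, by ext x; exact LinearMap.congr_fun hg x⟩

lemma exists_epi_of_module_projective (M : FGModuleCat.{u} A) :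
    ∃ (P : FGModuleCat.{u} A) (_ : Module.Projective A P) (f : P ⟶ M), Epi f := by
  obtain ⟨n, f, hf⟩ := Module.Finite.exists_fin' A M
  exact ⟨FGModuleCat.of A (Fin n → A), inferInstanceAs (Module.Projective A (Fin n → A)),
    FGModuleCat.ofHom f, (epi_iff_surjective _).2 hf⟩

instance : EnoughProjectives (FGModuleCat.{u} A) where
  presentation M := by
    obtain ⟨P, hP, f, hf⟩ := exists_epi_of_module_projective M
    exact ⟨{ p := P, projective := projective_of_module_projective hP, f := f, epi := hf }⟩

lemma projective_iff (M : FGModuleCat.{u} A) : Projective M ↔ Module.Projective A M := by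
  refine ⟨fun _ ↦ ?_, projective_of_module_projective⟩
  obtain ⟨P, hP, f, hf⟩ := exists_epi_of_module_projective M
  refine Module.Projective.of_split (Projective.factorThru (𝟙 M) f).hom.hom f.hom.hom ?_
  ext x
  have h := Projective.factorThru_comp (𝟙 M) f
  exact congr($(h).hom.hom x)

variable [IsArtinianRing A]

lemma moduleLength_eq_zero_iff (M : FGModuleCat.{u} A) : moduleLength M = 0 ↔ IsZero M := by
  rw [isZero_iff_subsingleton, moduleLength, ENat.toNat_eq_zero, Module.length_eq_zero_iff,
    or_iff_left Module.length_ne_top]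

lemma moduleLength_of_shortExact {S : ShortComplex (FGModuleCat.{u} A)} (hS : S.ShortExact) :
    moduleLength S.X₂ = moduleLength S.X₁ + moduleLength S.X₃ := by
  have hex : Function.Exact S.f.hom.hom S.g.hom.hom :=
    (ShortComplex.ShortExact.moduleCat_exact_iff_function_exact
      (S.map (forget₂ (FGModuleCat.{u} A) (ModuleCat.{u} A)))).1
        (hS.map_of_exact (forget₂ (FGModuleCat.{u} A) (ModuleCat.{u} A))).exact
  have h := Module.length_eq_add_of_exact S.f.hom.hom S.g.hom.hom
    ((mono_iff_injective _).1 hS.mono_f) ((epi_iff_surjective _).1 hS.epi_g) hex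
  rw [moduleLength, moduleLength, moduleLength, ← ENat.toNat_add Module.length_ne_top
    Module.length_ne_top]
  exact congr_arg _ h

lemma nonempty_retract_of_mono {M : FGModuleCat.{u} A} (f : M ⟶ radicalQuotient A) [Mono f] :
    Nonempty (Retract M (radicalQuotient A)) := by
  obtain ⟨g, hg⟩ := IsSemisimpleModule.extension_property f.hom.hom
    ((mono_iff_injective f).1 inferInstance) (LinearMap.id : M →ₗ[A] M)
  exact ⟨⟨f, FGModuleCat.ofHom g, by ext x; exact LinearMap.congr_fun hg x⟩⟩

/-- Dévissage: a property of finitely generated modules over an artinian ring that holds for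
`A ⧸ J` and is stable under retracts and extensions holds for every module. -/
lemma devissage (Φ : FGModuleCat.{u} A → Prop)
    (hext : ∀ S : ShortComplex (FGModuleCat.{u} A), S.ShortExact → Φ S.X₁ → Φ S.X₃ → Φ S.X₂)
    (hret : ∀ M N : FGModuleCat.{u} A, Retract M N → Φ N → Φ M)
    (h : Φ (radicalQuotient A)) (M : FGModuleCat.{u} A) : Φ M := by
  induction hn : moduleLength M using Nat.strong_induction_on generalizing M with
  | _ n ih =>
    by_cases hM : IsZero M
    · exact hret M _ ⟨0, 0, hM.eq_of_src _ _⟩ h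
    obtain ⟨f, hf⟩ := exists_ne_zero_to_radicalQuotient M hM
    let S : ShortComplex (FGModuleCat.{u} A) := ShortComplex.mk (kernel.ι f)
      (Abelian.factorThruImage f) (by
        rw [← cancel_mono (Abelian.image.ι f)]
        simp)
    have hS : S.ShortExact := by
      let φ : S ⟶ ShortComplex.mk (kernel.ι f) f (kernel.condition f) :=
        { τ₁ := 𝟙 _, τ₂ := 𝟙 _, τ₃ := Abelian.image.ι f }
      have : IsIso φ.τ₂ := inferInstanceAs (IsIso (𝟙 _))
      have : Epi φ.τ₁ := inferInstanceAs (Epi (𝟙 _))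
      have : Mono φ.τ₃ := inferInstanceAs (Mono (Abelian.image.ι f))
      have : S.Exact := (ShortComplex.exact_iff_of_epi_of_isIso_of_mono φ).2
        (ShortComplex.exact_kernel f)
      exact ShortComplex.ShortExact.mk' this (inferInstanceAs (Mono (kernel.ι f)))
        (inferInstanceAs (Epi (Abelian.factorThruImage f)))
    have hI : moduleLength S.X₃ ≠ 0 := by
      rw [Ne, moduleLength_eq_zero_iff]
      intro h0
      apply hf
      rw [← Abelian.image.fac f, h0.eq_of_src (Abelian.image.ι f) 0, comp_zero]
    have hl := moduleLength_of_shortExact hS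
    refine hext S hS (ih _ ?_ _ rfl) ?_
    · rw [← hn, show moduleLength M = _ from hl]
      lia
    · obtain ⟨r⟩ := nonempty_retract_of_mono (Abelian.image.ι f)
      exact hret _ _ r h

end Modules

/-! ### Minimal perfect complexes -/

section Support

variable {A : Type u} [Ring A]

lemma IsPerfect.exists_support_bounds {P : CochainComplex (FGModuleCat.{u} A) ℤ}
    (hP : IsPerfect P) (h : ¬ IsZero P) :
    ∃ r s : ℤ, ¬ IsZero (P.X r) ∧ ¬ IsZero (P.X s) ∧ ∀ i, ¬ IsZero (P.X i) → r ≤ i ∧ i ≤ s := by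
  obtain ⟨-, a, b, _, _⟩ := hP
  have hne : ∃ i, ¬ IsZero (P.X i) := by
    by_contra! h'
    apply h
    rw [IsZero.iff_id_eq_zero]
    ext i : 1
    exact (h' i).eq_of_src _ _
  obtain ⟨r, hr, hr'⟩ := Int.exists_least_of_bdd (P := fun i ↦ ¬ IsZero (P.X i)) ⟨a, fun i hi ↦ by
    by_contra! h
    exact hi (P.isZero_of_isStrictlyGE a i h)⟩ hne
  obtain ⟨s, hs, hs'⟩ := Int.exists_greatest_of_bdd (P := fun i ↦ ¬ IsZero (P.X i))
    ⟨b, fun i hi ↦ by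
      by_contra! h
      exact hi (P.isZero_of_isStrictlyLE b i h)⟩ hne
  exact ⟨r, s, hr, hs, fun i hi ↦ ⟨hr' i hi, hs' i hi⟩⟩

lemma isStrictlyGE_isStrictlyLE_of_support {P : CochainComplex (FGModuleCat.{u} A) ℤ} {r s : ℤ}
    (h : ∀ i, ¬ IsZero (P.X i) → r ≤ i ∧ i ≤ s) : P.IsStrictlyGE r ∧ P.IsStrictlyLE s := by
  rw [CochainComplex.isStrictlyGE_iff, CochainComplex.isStrictlyLE_iff]
  constructor
  all_goals
    intro i hi
    by_contra h0
    have := h i h0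
    lia

end Support

section Minimal

variable {A : Type u} [Ring A] [IsNoetherianRing A]

lemma isZero_Q_identityComplex (M : FGModuleCat.{u} A) (i : ℤ) :
    IsZero (Q.obj (identityComplex M i)) := by
  have hi : i ≠ i + 1 := by lia
  have hr : (ComplexShape.up ℤ).Rel i (i + 1) := rfl
  have hd : IsIso ((identityComplex M i).d i (i + 1)) := by
    rw [show (identityComplex M i).d i (i + 1) = _ from HomologicalComplex.double_d (𝟙 M) hr hi,
      Category.id_comp]
    exact (HomologicalComplex.doubleXIso₀ (𝟙 M) hr ≪≫
      (HomologicalComplex.doubleXIso₁ (𝟙 M) hr hi).symm).isIso_hom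
  have hex : ∀ j, (identityComplex M i).ExactAt j := by
    intro j
    by_cases h₀ : j = i
    · subst h₀
      rw [HomologicalComplex.exactAt_iff' _ (j - 1) j (j + 1) (by simp) (by simp)]
      exact (ShortComplex.exact_iff_mono _
        (HomologicalComplex.double_d_eq_zero₁ (𝟙 M) hr _ _ hi)).2
          (inferInstanceAs (Mono ((identityComplex M j).d j (j + 1))))
    by_cases h₁ : j = i + 1
    · subst h₁
      rw [HomologicalComplex.exactAt_iff' _ i (i + 1) (i + 1 + 1) (by simp) (by simp)]
      exact (ShortComplex.exact_iff_epi _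
        (HomologicalComplex.double_d_eq_zero₀ (𝟙 M) hr _ _ hi.symm)).2
          (inferInstanceAs (Epi ((identityComplex M i).d i (i + 1))))
    · exact HomologicalComplex.ExactAt.of_isZero
        (HomologicalComplex.isZero_double_X (𝟙 M) hr j h₀ h₁)
  have : (identityComplex M i).IsGE 1 := by
    rw [CochainComplex.isGE_iff]
    exact fun j _ ↦ hex j
  have : (identityComplex M i).IsLE 0 := by
    rw [CochainComplex.isLE_iff]
    exact fun j _ ↦ hex j
  exact TStructure.t.isZero _ 0 1 (by lia)

/-- Removing a contractible summand does not change the object of the derived category. -/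
lemma nonempty_iso_Q_of_iso_biprod {P R : CochainComplex (FGModuleCat.{u} A) ℤ}
    {M : FGModuleCat.{u} A} {i : ℤ} (e : P ≅ identityComplex M i ⊞ R) :
    Nonempty (Q.obj P ≅ Q.obj R) := by
  have h : Q.map (biprod.fst ≫ biprod.inl : identityComplex M i ⊞ R ⟶ identityComplex M i ⊞ R) = 0 := by
    rw [Functor.map_comp, (isZero_Q_identityComplex M i).eq_of_tgt (Q.map biprod.fst) 0, zero_comp]
  refine ⟨Q.mapIso e ≪≫ ⟨Q.map biprod.snd, Q.map biprod.inr, ?_, ?_⟩⟩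
  · rw [← Functor.map_comp, ← CategoryTheory.Functor.map_id, ← biprod.total, Functor.map_add, h,
      zero_add]
  · rw [← Functor.map_comp, biprod.inr_snd, CategoryTheory.Functor.map_id]

variable [IsArtinianRing A]

lemma moduleLength_X_of_iso_biprod {P K R : CochainComplex (FGModuleCat.{u} A) ℤ}
    (e : P ≅ K ⊞ R) (j : ℤ) :
    moduleLength (P.X j) = moduleLength (K.X j) + moduleLength (R.X j) := by
  let σ := (ShortComplex.Splitting.ofHasBinaryBiproduct K R).map
    (HomologicalComplex.eval (FGModuleCat.{u} A) (ComplexShape.up ℤ) j)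
  rw [show moduleLength (P.X j) = _ from
    moduleLength_of_iso ((HomologicalComplex.eval _ _ j).mapIso e)]
  exact moduleLength_of_shortExact σ.shortExact

/-- Contractible summands are split off until none is left; the total length `n` of the terms
decreases strictly. -/
lemma exists_minimal_aux (a b : ℤ) (n : ℕ) :
    ∀ P : CochainComplex (FGModuleCat.{u} A) ℤ, (∀ i, Projective (P.X i)) →
      P.IsStrictlyGE a → P.IsStrictlyLE b → ∑ i ∈ Finset.Icc a b, moduleLength (P.X i) = n →
      ∃ P' : CochainComplex (FGModuleCat.{u} A) ℤ, IsPerfect P' ∧ IsMinimal P' ∧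
        Nonempty (Q.obj P ≅ Q.obj P') := by
  induction n using Nat.strong_induction_on with
  | _ n ih =>
    intro P hP ha hb hn
    by_cases hmin : IsMinimal P
    · exact ⟨P, ⟨fun i ↦ (projective_iff _).1 (hP i), a, b, ha, hb⟩, hmin, ⟨Iso.refl _⟩⟩
    simp only [IsMinimal, not_forall] at hmin
    obtain ⟨M, i, R, hM, e, hM0⟩ := hmin
    let r (j : ℤ) : Retract (R.X j) (P.X j) :=
      (Retract.mk (biprod.inr ≫ e.inv) (e.hom ≫ biprod.snd) (by simp) : Retract R P).map
        (HomologicalComplex.eval _ _ j)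
    have hR0 (j : ℤ) (h : IsZero (P.X j)) : IsZero (R.X j) := by
      rw [IsZero.iff_id_eq_zero, ← (r j).retract, h.eq_of_src (r j).r 0, comp_zero]
    have hlen := moduleLength_X_of_iso_biprod e
    have hMi : moduleLength ((identityComplex M i).X i) ≠ 0 := by
      rw [show moduleLength ((identityComplex M i).X i) = _ from
        moduleLength_of_iso (HomologicalComplex.doubleXIso₀ (𝟙 M) _), Ne, moduleLength_eq_zero_iff]
      exact hM0
    have hi : i ∈ Finset.Icc a b := by
      rw [Finset.mem_Icc]
      by_contra hi
      have : moduleLength (P.X i) = 0 := by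
        rw [moduleLength_eq_zero_iff]
        by_cases h : i < a
        · exact P.isZero_of_isStrictlyGE a i h
        · exact P.isZero_of_isStrictlyLE b i (by lia)
      have := hlen i
      lia
    obtain ⟨P', h₁, h₂, ⟨e'⟩⟩ := ih (∑ i ∈ Finset.Icc a b, moduleLength (R.X i))
      (by
        rw [← hn]
        exact Finset.sum_lt_sum (fun j _ ↦ by rw [hlen j]; lia) ⟨i, hi, by rw [hlen i]; lia⟩)
      R (fun j ↦ by have := hP j; exact (r j).projective)
      ((R.isStrictlyGE_iff a).2 fun j hj ↦ hR0 j (P.isZero_of_isStrictlyGE a j hj))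
      ((R.isStrictlyLE_iff b).2 fun j hj ↦ hR0 j (P.isZero_of_isStrictlyLE b j hj)) rfl
    obtain ⟨e''⟩ := nonempty_iso_Q_of_iso_biprod e
    exact ⟨P', h₁, h₂, ⟨e'' ≪≫ e'⟩⟩

lemma exists_minimal {X : DerivedCategory (FGModuleCat.{u} A)} (hX : IsPerfectObject X) :
    ∃ P : CochainComplex (FGModuleCat.{u} A) ℤ, IsPerfect P ∧ IsMinimal P ∧
      Nonempty (X ≅ Q.obj P) := by
  obtain ⟨P, a, b, hP, ha, hb, ⟨e⟩⟩ := hX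
  obtain ⟨P', h₁, h₂, ⟨e'⟩⟩ := exists_minimal_aux a b _ P hP ha hb rfl
  exact ⟨P', h₁, h₂, ⟨e ≪≫ e'⟩⟩

lemma HomVanishes.of_radicalQuotient {Z : DerivedCategory (FGModuleCat.{u} A)} {n : ℤ}
    (h : HomVanishes Z n (radicalQuotient A)) (M : FGModuleCat.{u} A) : HomVanishes Z n M :=
  devissage (HomVanishes Z n) (fun _ hS ↦ HomVanishes.of_shortExact hS)
    (fun _ _ r ↦ HomVanishes.of_retract r) h M

lemma IsMinimal.not_homVanishes_first {P : CochainComplex (FGModuleCat.{u} A) ℤ}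
    [∀ i, Projective (P.X i)] (hP : IsMinimal P) {r s : ℤ} [P.IsStrictlyGE r] [P.IsStrictlyLE s]
    (hr : ¬ IsZero (P.X r)) : ¬ HomVanishes (Q.obj P) r (radicalQuotient A) := by
  intro h
  obtain ⟨β, hβ⟩ := exists_d_comp_eq_id_of_homVanishes (s := s) h.of_radicalQuotient
  obtain ⟨R, ⟨e⟩⟩ := exists_iso_double_biprod P (𝟙 (P.X r)) β (by simpa using hβ)
  exact hr (hP _ r R ((projective_iff _).1 inferInstance) e)

lemma IsMinimal.not_homVanishes_last {P : CochainComplex (FGModuleCat.{u} A) ℤ}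
    [∀ i, Projective (P.X i)] (hP : IsMinimal P) {s : ℤ} [P.IsStrictlyLE s]
    (hs : ¬ IsZero (P.X s)) : ¬ HomVanishes (Q.obj P) s (radicalQuotient A) := by
  intro h
  obtain ⟨i, rfl⟩ : ∃ i, s = i + 1 := ⟨s - 1, by lia⟩
  obtain ⟨α, hα⟩ := exists_comp_d_eq_id_of_homVanishes h.of_radicalQuotient
  obtain ⟨R, ⟨e⟩⟩ := exists_iso_double_biprod P α (𝟙 (P.X (i + 1))) (by simpa using hα)
  exact hs (hP _ i R ((projective_iff _).1 inferInstance) e)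

end Minimal

/-! ### Transport along an equivalence -/

section Equivalence

variable {A : Type u} [Ring A] [IsNoetherianRing A] {B : Type v} [Ring B] [IsNoetherianRing B]

/-- The module `M` placed in degree `n`, as an object of the bounded derived category. -/
noncomputable def stalk (M : FGModuleCat.{u} A) (n : ℤ) : Db A :=
  ⟨(singleFunctor _ n).obj M, bounded_single M n⟩

lemma nonempty_stalk_iso_shift (M : FGModuleCat.{u} A) (n : ℤ) :
    Nonempty (stalk M n ≅ (stalk M 0)⟦-n⟧) :=
  ⟨ObjectProperty.isoMk _ (((singleFunctors _).shiftIso (-n) n 0 (by lia)).symm.app M ≪≫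
    ((ObjectProperty.ι _).commShiftIso (-n)).symm.app (stalk M 0))⟩

/-- The images of the stalk complexes of `M` have cohomology in a fixed distance from the degree of
the stalk, because they are shifts of one another. -/
lemma exists_bounds_obj_stalk (F : Db A ⥤ Db B) [F.CommShift ℤ] (M : FGModuleCat.{u} A) :
    ∃ c : ℤ, ∀ n, (F.obj (stalk M n)).obj.IsGE (n - c) ∧ (F.obj (stalk M n)).obj.IsLE (n + c) := by
  obtain ⟨⟨a, _⟩, ⟨b, _⟩⟩ := (F.obj (stalk M 0)).property
  refine ⟨max (-a) b, fun n ↦ ?_⟩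
  obtain ⟨e⟩ := nonempty_stalk_iso_shift M n
  let e' : (F.obj (stalk M n)).obj ≅ ((F.obj (stalk M 0)).obj)⟦-n⟧ :=
    (ObjectProperty.ι _).mapIso (F.mapIso e ≪≫ (F.commShiftIso (-n)).app _) ≪≫
      ((ObjectProperty.ι _).commShiftIso (-n)).app _
  have h₁ := TStructure.t.isGE_shift (F.obj (stalk M 0)).obj a (-n) (a + n)
  have h₂ := TStructure.t.isLE_shift (F.obj (stalk M 0)).obj b (-n) (b + n)
  have h₃ := TStructure.t.isGE_of_iso e'.symm (a + n)
  have h₄ := TStructure.t.isLE_of_iso e'.symm (b + n)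
  exact ⟨TStructure.t.isGE_of_ge _ _ (a + n) (by lia), TStructure.t.isLE_of_le _ (b + n) _ (by lia)⟩

lemma IsExceptional.obj {X : Db B} (hX : IsExceptional X) (G : Db B ⥤ Db A) [G.Full]
    [G.CommShift ℤ] [G.PreservesZeroMorphisms] : IsExceptional (G.obj X) := by
  intro n hn f
  obtain ⟨h, hh⟩ := G.map_surjective (f ≫ (G.commShiftIso n).inv.app X)
  rw [hX n hn h, G.map_zero] at hh
  rw [← cancel_mono ((G.commShiftIso n).inv.app X), ← hh, zero_comp]

lemma indecomposable_obj {D D' : Type*} [Category* D] [Category* D'] [Preadditive D]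
    [Preadditive D'] [HasBinaryBiproducts D] [HasBinaryBiproducts D'] [HasZeroObject D]
    [HasZeroObject D'] (E : D ≌ D') [E.functor.Additive] {X : D'} (hX : Indecomposable X) :
    Indecomposable (E.inverse.obj X) := by
  refine ⟨fun h ↦ hX.1 ?_, fun Y Z e ↦ ?_⟩
  · exact (E.functor.map_isZero h).of_iso (E.counitIso.symm.app X)
  · have := preservesBinaryBiproducts_of_preservesBinaryProducts E.functor
    let e' : X ≅ E.functor.obj Y ⊞ E.functor.obj Z :=
      E.counitIso.symm.app X ≪≫ E.functor.mapIso e ≪≫ E.functor.mapBiprod Y Z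
    exact (hX.2 _ _ e').imp (fun h ↦ .of_full_of_faithful_of_isZero E.functor _ h)
      (fun h ↦ .of_full_of_faithful_of_isZero E.functor _ h)

lemma eq_zero_of_bounds {P : CochainComplex (FGModuleCat.{u} A) ℤ} [∀ i, Projective (P.X i)]
    {r s : ℤ} [P.IsStrictlyGE r] [P.IsStrictlyLE s] {X : Db A} (e : X.obj ≅ Q.obj P) {Y : Db A}
    {a b : ℤ} (ha : Y.obj.IsGE a) (hb : Y.obj.IsLE b) (h : b < r ∨ s < a) (f : X ⟶ Y) : f = 0 := by
  have : e.inv ≫ f.hom = 0 := by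
    obtain h | h := h
    · exact eq_zero_of_isLE_of_projective (s := s) h _
    · exact TStructure.t.zero _ s a h
  ext
  rw [← cancel_epi e.inv, this]
  exact comp_zero.symm

/-- An equivalence preserves perfect objects: morphisms from `E.inverse.obj X` to `(A ⧸ J)[-n]`
correspond to morphisms from `X` to an object with cohomology near the degree `n`, which vanish for
`n` small since `X` is perfect. -/
lemma isPerfectObject_obj [IsArtinianRing A] (E : Db A ≌ Db B) [E.functor.CommShift ℤ]
    [E.functor.PreservesZeroMorphisms] {X : Db B}
    {P : CochainComplex (FGModuleCat.{v} B) ℤ} [∀ i, Projective (P.X i)]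
    {r s : ℤ} [P.IsStrictlyGE r] [P.IsStrictlyLE s] (e : X.obj ≅ Q.obj P) :
    IsPerfectObject (E.inverse.obj X).obj := by
  obtain ⟨c, hc⟩ := exists_bounds_obj_stalk E.functor (radicalQuotient A)
  obtain ⟨-, ⟨b, hb⟩⟩ := (E.inverse.obj X).property
  refine isPerfectObject_of_homVanishes (m := r - c) (b - (r - c)).toNat _
    (E.inverse.obj X).property (TStructure.t.isLE_of_le _ b _ (by lia)) fun n hn M ↦ ?_
  refine HomVanishes.of_radicalQuotient (fun f ↦ ?_) M
  let g : E.inverse.obj X ⟶ stalk (radicalQuotient A) n := ObjectProperty.homMk f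
  have hg : (E.counitIso.inv.app X ≫ E.functor.map g) = 0 :=
    eq_zero_of_bounds (r := r) (s := s) e (hc n).1 (hc n).2 (by lia) _
  have hg' : g = 0 := by
    apply E.functor.map_injective
    rw [← cancel_epi (E.counitIso.inv.app X), hg, E.functor.map_zero, comp_zero]
  exact congr_arg InducedCategory.Hom.hom hg'

end Equivalence

/-- Up to a constant depending only on the equivalence, the length of `X` is at most the length of
its image in `D^b(A)`. -/
lemma BoundedExceptionalLengths.of_derivedEquivalent
    {A : Type u} [Ring A] [IsNoetherianRing A] [IsArtinianRing A]
    {B : Type v} [Ring B] [IsNoetherianRing B] [IsArtinianRing B]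
    (h : DerivedEquivalent A B) (hA : BoundedExceptionalLengths A) :
    BoundedExceptionalLengths B := by
  obtain ⟨E, _, _⟩ := h
  let _ := E.commShiftInverse ℤ
  obtain ⟨N, hN⟩ := hA
  obtain ⟨c, hc⟩ := exists_bounds_obj_stalk E.inverse (radicalQuotient B)
  refine ⟨N + 2 * c, ?_⟩
  rintro l ⟨X, hind, -, hexc, P, hP, hmin, ⟨e⟩, r, s, hr, hs, hrs, rfl⟩
  have hproj : ∀ i, Projective (P.X i) := fun i ↦ (projective_iff _).2 (hP.1 i)
  obtain ⟨_, _⟩ := isStrictlyGE_isStrictlyLE_of_support hrs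
  have hind' := indecomposable_obj E hind
  obtain ⟨P', hP', hmin', ⟨e'⟩⟩ := exists_minimal
    (isPerfectObject_obj E (r := r) (s := s) e)
  have hP0 : ¬ IsZero P' := fun h0 ↦ by
    have : IsZero (E.inverse.obj X).obj := (Q.map_isZero h0).of_iso e'
    exact hind'.1 (IsZero.of_full_of_faithful_of_isZero (ObjectProperty.ι _) _ this)
  obtain ⟨r', s', hr', hs', hrs'⟩ := IsPerfect.exists_support_bounds hP' hP0
  have hproj' : ∀ i, Projective (P'.X i) := fun i ↦ (projective_iff _).2 (hP'.1 i)
  obtain ⟨_, _⟩ := isStrictlyGE_isStrictlyLE_of_support hrs'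
  have hl : s' - r' + 1 ≤ N := hN ⟨E.inverse.obj X, hind', ⟨P', hP', ⟨e'⟩⟩,
    hexc.obj E.inverse, P', hP', hmin', ⟨e'⟩, r', s', hr', hs', hrs', rfl⟩
  have key (n : ℤ) (hn : n + c < r' ∨ s' < n - c) :
      HomVanishes (Q.obj P) n (radicalQuotient B) := by
    intro f
    let g : X ⟶ stalk (radicalQuotient B) n := ObjectProperty.homMk (e.hom ≫ f)
    have hg : g = 0 := by
      apply E.inverse.map_injective
      rw [E.inverse.map_zero]
      exact eq_zero_of_bounds (r := r') (s := s') e' (hc n).1 (hc n).2 hn _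
    rw [← cancel_epi e.hom, comp_zero]
    exact congr_arg InducedCategory.Hom.hom hg
  have h₁ := mt (key r) (hmin.not_homVanishes_first (s := s) hr)
  have h₂ := mt (key s) (hmin.not_homVanishes_last hs)
  lia

end DerivedLength

theorem theorem2p2 {k : Type*} [Field k] [IsAlgClosed k]
    {A : Type*} [Ring A] [Algebra k A] [Module.Finite k A]
    {B : Type*} [Ring B] [Algebra k B] [Module.Finite k B]
    (hA : DerivedLength.IsConnected k A) (hA' : DerivedLength.IsBasic A)
    (hB : DerivedLength.IsConnected k B) (hB' : DerivedLength.IsBasic B) :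
    haveI : IsNoetherianRing A := IsNoetherianRing.of_finite k A
    haveI : IsNoetherianRing B := IsNoetherianRing.of_finite k B
    DerivedLength.DerivedEquivalent A B →
      DerivedLength.BoundedExceptionalLengths A →
        DerivedLength.BoundedExceptionalLengths B := by
  have : IsNoetherianRing A := IsNoetherianRing.of_finite k A
  have : IsNoetherianRing B := IsNoetherianRing.of_finite k B
  have : IsArtinianRing A := IsArtinianRing.of_finite k A
  have : IsArtinianRing B := IsArtinianRing.of_finite k B
  exact DerivedLength.BoundedExceptionalLengths.of_derivedEquivalent
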